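/- **Definitions.** A *support fabric* is a pair $\mathcal F=(I,\mathcal H)$ with $I$ a finite set and $\mathcal H$ a set of subsets of $I$ (the *strata*) such that $J'\subset J\in\mathcal H$ implies $J'\in\mathcal H$. For a set $A\subset\mathbb R^J_{\ge 0}$ let $[[A]]$ be the convex hull of $A+\mathbb R^J_{\ge0}$. A *polyhedra system* with denominator $d\in\mathbb Z_{>0}$ is a triple $\mathcal D=(\mathcal F;\{\Delta_J\}_{J\in\mathcal H},d)$ where each $\Delta_J\subset\mathbb R^J_{\ge0}$ is non-empty and of the form $[[A]]$ with $A\subset\frac1d\mathbb Z^J_{\ge0}$, and $\Delta_{J_1}$ is the image of $\Delta_{J_2}$ under the restriction map $\mathbb R^{J_2}\to\mathbb R^{J_1}$ whenever $J_1\subset J_2$ are strata. If $d=1$ it is a *Newton polyhedra system*. Put $N(\mathcal D)=(\mathcal F;\{d\Delta_J\},1)$ and $\mathcal D/d'=(\mathcal F;\{\frac1{d'}\Delta_J\},dd')$ for an integer $d'\ge1$. The *contact exponent* is $\delta(\Delta_J)=\min\{\sum_{j\in J}\sigma(j):\sigma\in\Delta_J\}$ if $J\neq\emptyset$, and $\delta(\Delta_\emptyset)=-1$;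 moreover $\delta(\mathcal D)=\max_{J\in\mathcal H}\delta(\Delta_J)$ (which is $-\infty$ if $\mathcal H=\emptyset$) and $\mathrm{Sing}(\mathcal D)=\{J\in\mathcal H:\delta(\Delta_J)\ge1\}$. The *blow-up* of $\mathcal F$ centered in a non-empty $J\in\mathcal H$ is $\pi_J(\mathcal F)=(I\cup\{\infty\},\mathcal H')$, $\infty\notin I$, where $\mathcal H'$ consists of the strata $L\in\mathcal H$ with $J\not\subset L$ and of the sets $J'=(K\setminus J)\cup A\cup\{\infty\}$ with $J\subset K\in\mathcal H$ and $A\subsetneq J$; for the latter define $\lambda_{J'}:\mathbb R^K\to\mathbb R^{J'}$ by $\lambda_{J'}(\sigma)(j)=\sigma(j)$ for $j\ne\infty$ and $\lambda_{J'}(\sigma)(\infty)=\sum_{j\in J}\sigma(j)$. For $J\in\mathrm{Sing}(\mathcal D)$ the *characteristic transform* $\Lambda_J(\mathcal D)$ is the polyhedra system $(\pi_J(\mathcal F);\{\Delta'_{J'}\}_{J'\in\mathcal H'},d)$ with $\Delta'_{J'}=\Delta_{J'}$ if $\infty\notin J'$, and $\Delta'_{J'}=[[\lambda_{J'}(\Delta_K)]]-e_{\infty}$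 if $\infty\in J'$, where $e_\infty\in\mathbb R^{J'}$ is the standard basis vector of index $\infty$. For a Newton polyhedra system $\mathcal N$, an integer $d\ge1$ and $J\in\mathrm{Sing}(\mathcal N/d)$, the *$d$-moderated transform* of $\mathcal N$ centered in $J$ is $\Theta^d_J(\mathcal N)=N(\Lambda_J(\mathcal N/d))$. **Corollary.** Let $\mathcal N$ be a Newton polyhedra system and let $d\ge1$ be an integer. There are $k\ge0$ and a finite sequence $$\mathcal N=\mathcal N_0\to\mathcal N_1\to\cdots\to\mathcal N_k$$ in which each $\mathcal N_{i+1}$ is a $d$-moderated transform $\Theta^d_{J_i}(\mathcal N_i)$ of $\mathcal N_i$ centered in some $J_i\in\mathrm{Sing}(\mathcal N_i/d)$, such that $\delta(\mathcal N_k)<d$. -/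

import Mathlib

open scoped Pointwise

universe u

/-- A support fabric `(I, 𝓗)`: a finite index set `I` and a set `𝓗` of subsets of `I` (the strata)
that is open for the Zariski topology on the power set of `I`, i.e. stable under taking subsets. -/
structure SupportFabric where
  I : Type u
  [fintype : Fintype I]
  [decEq : DecidableEq I]
  strata : Set (Finset I)
  isOpen : ∀ J ∈ strata, ∀ J' ⊆ J, J' ∈ strata

attribute [instance] SupportFabric.fintype SupportFabric.decEq

namespace SupportFabric

/-- The strata `𝓗' = 𝓗'_s ∪ 𝓗'_∞` of the blow-up centered in `J`; the new index `∞` is `none`,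
and an old index `i` is `some i`. -/
def blowUpStrata (F : SupportFabric.{u}) (J : Finset F.I) : Set (Finset (Option F.I)) :=
  {J' | ∃ L ∈ F.strata, ¬ J ⊆ L ∧ J' = L.map Function.Embedding.some} ∪
  {J' | ∃ K ∈ F.strata, J ⊆ K ∧ ∃ A, A ⊂ J ∧ J' = Finset.insertNone ((K \ J) ∪ A)}

theorem blowUpStrata_isOpen (F : SupportFabric.{u}) (J : Finset F.I) :
    ∀ J' ∈ F.blowUpStrata J, ∀ J'' ⊆ J', J'' ∈ F.blowUpStrata J := by
  classical
  rintro J' (⟨L, hL, hJL, rfl⟩ | ⟨K, hK, hJK, A, hA, rfl⟩) M hM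
  · refine Or.inl ⟨M.eraseNone, F.isOpen L hL _ ?_, fun h => hJL (h.trans ?_), ?_⟩
    · intro x hx
      simpa using hM (Finset.mem_eraseNone.1 hx)
    · intro x hx
      simpa using hM (Finset.mem_eraseNone.1 hx)
    · ext x
      cases x with
      | none => simpa using fun h => by simpa using hM h
      | some x => simp
  · have hsub : ∀ x, some x ∈ M → (x ∈ K ∧ x ∉ J) ∨ x ∈ A := by
      intro x hx
      simpa using hM hx
    have hMK : M.eraseNone ⊆ K := by
      intro x hx
      rcases hsub x (Finset.mem_eraseNone.1 hx) with h | h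
      · exact h.1
      · exact hJK (hA.1 h)
    by_cases hn : none ∈ M
    · refine Or.inr ⟨(M.eraseNone \ J) ∪ J, F.isOpen K hK _ ?_, Finset.subset_union_right,
        M.eraseNone ∩ J, ?_, ?_⟩
      · exact Finset.union_subset (Finset.sdiff_subset.trans hMK) hJK
      · refine ⟨Finset.inter_subset_right, fun h => hA.2 fun x hx => ?_⟩
        have := (Finset.mem_inter.1 (h hx)).1
        rcases hsub x (Finset.mem_eraseNone.1 this) with h | h
        · exact absurd hx h.2
        · exact h
      · ext x
        cases x with
        | none => simpa using hn
        | some x => simp; tauto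
    · refine Or.inl ⟨M.eraseNone, F.isOpen K hK _ hMK, fun h => hA.2 fun x hx => ?_, ?_⟩
      · rcases hsub x (Finset.mem_eraseNone.1 (h hx)) with h | h
        · exact absurd hx h.2
        · exact h
      · ext x
        cases x with
        | none => simpa using hn
        | some x => simp

/-- The blow-up `π_J(F)` centered in `J` (meant for a non-empty stratum `J`). -/
def blowUp (F : SupportFabric.{u}) (J : Finset F.I) : SupportFabric.{u} where
  I := Option F.I
  strata := F.blowUpStrata J
  isOpen := F.blowUpStrata_isOpen J

/-- The map `π_J^#`: it sends `(K \ J) ∪ A ∪ {∞}` to `K` and is the identity on strata without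
`∞`; see `blowUpMap_insertNone` and `blowUpMap_map_some`. -/
def blowUpMap (F : SupportFabric.{u}) (J : Finset F.I) (J' : Finset (Option F.I)) : Finset F.I :=
  if none ∈ J' then J'.eraseNone ∪ J else J'.eraseNone

theorem blowUpMap_insertNone (F : SupportFabric.{u}) {J K A : Finset F.I} (hJK : J ⊆ K)
    (hA : A ⊂ J) : F.blowUpMap J (Finset.insertNone ((K \ J) ∪ A)) = K := by
  ext x
  have h1 : x ∈ J → x ∈ K := fun h => hJK h
  have h2 : x ∈ A → x ∈ J := fun h => hA.1 h
  simp [blowUpMap]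
  tauto

theorem blowUpMap_map_some (F : SupportFabric.{u}) (J L : Finset F.I) :
    F.blowUpMap J (L.map Function.Embedding.some) = L := by
  simp [blowUpMap]

theorem blowUpMap_mem (F : SupportFabric.{u}) {J : Finset F.I} {J' : Finset (Option F.I)}
    (h : J' ∈ F.blowUpStrata J) : F.blowUpMap J J' ∈ F.strata := by
  rcases h with ⟨L, hL, hJL, rfl⟩ | ⟨K, hK, hJK, A, hA, rfl⟩
  · rwa [blowUpMap_map_some]
  · rwa [blowUpMap_insertNone F hJK hA]

theorem mem_blowUpMap_of_some (F : SupportFabric.{u}) {J : Finset F.I}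
    {J' : Finset (Option F.I)} {i : F.I} (h : some i ∈ J') : i ∈ F.blowUpMap J J' := by
  unfold blowUpMap
  split_ifs <;> simp [h]

theorem subset_blowUpMap (F : SupportFabric.{u}) {J : Finset F.I}
    {J' : Finset (Option F.I)} (h : none ∈ J') : J ⊆ F.blowUpMap J J' := by
  simp [blowUpMap, h]

theorem blowUpMap_mono (F : SupportFabric.{u}) {J : Finset F.I}
    {J₁ J₂ : Finset (Option F.I)} (h : J₁ ⊆ J₂) : F.blowUpMap J J₁ ⊆ F.blowUpMap J J₂ := by
  intro x hx
  by_cases hn : none ∈ J₁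
  · simp only [blowUpMap, hn, h hn, if_true, Finset.mem_union, Finset.mem_eraseNone] at hx ⊢
    exact hx.imp (fun hx => h hx) id
  · simp only [blowUpMap, hn, if_false, Finset.mem_eraseNone] at hx
    exact F.mem_blowUpMap_of_some (h hx)

/-- The map `λ_{J'} : ℝ^K → ℝ^{J'}`, `K = π_J^#(J')`: coordinates `j ≠ ∞` are kept and the
coordinate `∞` (if `∞ ∈ J'`) is `∑_{j ∈ J} σ(j)`. If `∞ ∉ J'` it is the relabelling of
coordinates along `i ↦ some i`. -/
def blowUpLin (F : SupportFabric.{u}) (J : Finset F.I) (J' : Finset (Option F.I))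
    (σ : F.blowUpMap J J' → ℝ) : J' → ℝ
  | ⟨some i, h⟩ => σ ⟨i, F.mem_blowUpMap_of_some h⟩
  | ⟨none, h⟩ => ∑ j : J, σ ⟨j, F.subset_blowUpMap h j.2⟩

/-- The vector `e_{J',∞}`, the restriction to `J'` of the standard basis vector `e_∞`. -/
def eInfty {I : Type u} (J' : Finset (Option I)) : J' → ℝ
  | ⟨some _, _⟩ => 0
  | ⟨none, _⟩ => 1

end SupportFabric

/-- The positive convex hull `[[A]]`, the convex hull of `A + ℝ_{≥0}^J`. -/
def posConvexHull {ι : Type*} (A : Set (ι → ℝ)) : Set (ι → ℝ) :=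
  convexHull ℝ (A + {τ | ∀ j, 0 ≤ τ j})

/-- `Δ` is a characteristic polyhedron with denominator `d`: `Δ = [[A]]` for some
`A ⊆ (1/d) ℤ_{≥0}^J`. -/
def IsCharPolyhedron {ι : Type*} (d : ℕ) (Δ : Set (ι → ℝ)) : Prop :=
  ∃ A : Set (ι → ℝ), (∀ σ ∈ A, ∀ j, ∃ n : ℕ, σ j = (n : ℝ) / (d : ℝ)) ∧ Δ = posConvexHull A

/-- The contact exponent `δ(Δ) = min {|σ| ; σ ∈ Δ}` of a polyhedron `Δ ⊆ ℝ^J`, with the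
convention `-1` for `J = ∅`. (The minimum is attained when `Δ` is a non-empty characteristic
polyhedron.) -/
noncomputable def polyhedronContactExponent {I : Type u} {J : Finset I} (Δ : Set (J → ℝ)) : ℝ :=
  open Classical in
  if J = ∅ then -1 else sInf ((fun σ : J → ℝ => ∑ j, σ j) '' Δ)

/-- A polyhedra system `(F; {Δ_J}_{J ∈ 𝓗}, d)`, all of whose polyhedra are non-empty. -/
structure PolyhedraSystem where
  fabric : SupportFabric.{u}
  polyhedron : (J : fabric.strata) → Set (J.1 → ℝ)
  denom : ℕ
  denom_pos : 0 < denom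
  isChar : ∀ J, IsCharPolyhedron denom (polyhedron J)
  nonempty : ∀ J, (polyhedron J).Nonempty
  compat : ∀ (J₁ J₂ : fabric.strata) (h : (J₁ : Finset fabric.I) ⊆ (J₂ : Finset fabric.I)),
    polyhedron J₁ = Finset.restrict₂ (π := fun _ => ℝ) h '' polyhedron J₂

section PosConvexHull

variable {ι κ : Type*}

theorem convex_posOrthant : Convex ℝ {τ : ι → ℝ | ∀ j, 0 ≤ τ j} := by
  intro x hx y hy a b ha hb _ j
  exact add_nonneg (mul_nonneg ha (hx j)) (mul_nonneg hb (hy j))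

theorem posConvexHull_eq (A : Set (ι → ℝ)) :
    posConvexHull A = convexHull ℝ A + {τ | ∀ j, 0 ≤ τ j} := by
  rw [posConvexHull, convexHull_add, convex_posOrthant.convexHull_eq]

theorem subset_posConvexHull (A : Set (ι → ℝ)) : A ⊆ posConvexHull A := fun x hx =>
  subset_convexHull ℝ _ ⟨x, hx, 0, fun _ => le_rfl, add_zero x⟩

theorem posConvexHull_idem_aux {A : Set (ι → ℝ)} {x τ : ι → ℝ} (hx : x ∈ posConvexHull A)
    (hτ : ∀ j, 0 ≤ τ j) : x + τ ∈ posConvexHull A := by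
  rw [posConvexHull_eq] at hx ⊢
  obtain ⟨a, ha, t, ht, rfl⟩ := hx
  exact ⟨a, ha, t + τ, fun j => add_nonneg (ht j) (hτ j), (add_assoc _ _ _).symm⟩

theorem posConvexHull_min {A B : Set (ι → ℝ)} (h : A ⊆ posConvexHull B) :
    posConvexHull A ⊆ posConvexHull B := by
  refine convexHull_min ?_ (convex_convexHull ℝ _)
  rintro _ ⟨a, ha, t, ht, rfl⟩
  exact posConvexHull_idem_aux (h ha) ht

theorem posConvexHull_nonneg {A : Set (ι → ℝ)} (h : ∀ σ ∈ A, ∀ j, 0 ≤ σ j) :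
    ∀ σ ∈ posConvexHull A, ∀ j, 0 ≤ σ j := by
  refine convexHull_min ?_ convex_posOrthant
  rintro _ ⟨a, ha, t, ht, rfl⟩ j
  exact add_nonneg (h a ha j) (ht j)

/-- A linear map preserving the non-negative orthants is compatible with `[[·]]`. -/
theorem posConvexHull_image_posConvexHull (f : (ι → ℝ) →ₗ[ℝ] (κ → ℝ))
    (hf : ∀ τ, (∀ j, 0 ≤ τ j) → ∀ j, 0 ≤ f τ j) (A : Set (ι → ℝ)) :
    posConvexHull (f '' posConvexHull A) = posConvexHull (f '' A) := by
  apply subset_antisymm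
  · apply posConvexHull_min
    rintro _ ⟨x, hx, rfl⟩
    rw [posConvexHull_eq] at hx
    obtain ⟨a, ha, t, ht, rfl⟩ := hx
    rw [posConvexHull_eq, map_add]
    exact ⟨f a, by rw [← LinearMap.image_convexHull]; exact ⟨a, ha, rfl⟩, f t, hf t ht, rfl⟩
  · apply posConvexHull_min
    rintro _ ⟨x, hx, rfl⟩
    exact subset_posConvexHull _ ⟨x, subset_posConvexHull _ hx, rfl⟩

/-- A linear map carrying the non-negative orthant onto the other one commutes with `[[·]]`. -/
theorem image_posConvexHull (f : (ι → ℝ) →ₗ[ℝ] (κ → ℝ))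
    (hf : f '' {τ | ∀ j, 0 ≤ τ j} = {τ | ∀ j, 0 ≤ τ j}) (A : Set (ι → ℝ)) :
    f '' posConvexHull A = posConvexHull (f '' A) := by
  rw [posConvexHull_eq, posConvexHull_eq, Set.image_add, hf, ← LinearMap.image_convexHull]

end PosConvexHull

namespace SupportFabric

/-- `blowUpLin` as a linear map. -/
def blowUpLinearMap (F : SupportFabric.{u}) (J : Finset F.I) (J' : Finset (Option F.I)) :
    (F.blowUpMap J J' → ℝ) →ₗ[ℝ] (J' → ℝ) where
  toFun := F.blowUpLin J J'
  map_add' σ τ := by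
    ext ⟨j, hj⟩
    cases j with
    | none => simp [blowUpLin, Finset.sum_add_distrib]
    | some j => simp [blowUpLin]
  map_smul' c σ := by
    ext ⟨j, hj⟩
    cases j with
    | none => simp [blowUpLin, Finset.mul_sum]
    | some j => simp [blowUpLin]

theorem blowUpLin_nonneg (F : SupportFabric.{u}) (J : Finset F.I) (J' : Finset (Option F.I))
    (τ : F.blowUpMap J J' → ℝ) (h : ∀ j, 0 ≤ τ j) : ∀ j, 0 ≤ F.blowUpLin J J' τ j := by
  rintro ⟨j, hj⟩
  cases j with
  | none => exact Finset.sum_nonneg fun _ _ => h _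
  | some j => exact h _

theorem blowUpLin_restrict (F : SupportFabric.{u}) (J : Finset F.I)
    {J₁ J₂ : Finset (Option F.I)} (h : J₁ ⊆ J₂) (σ : F.blowUpMap J J₂ → ℝ) :
    F.blowUpLin J J₁ (Finset.restrict₂ (π := fun _ => ℝ) (F.blowUpMap_mono h) σ) =
      Finset.restrict₂ (π := fun _ => ℝ) h (F.blowUpLin J J₂ σ) := by
  ext ⟨j, hj⟩
  cases j with
  | none => rfl
  | some j => rfl

theorem eInfty_restrict {I : Type u} {J₁ J₂ : Finset (Option I)} (h : J₁ ⊆ J₂) :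
    Finset.restrict₂ (π := fun _ => ℝ) h (eInfty J₂) = eInfty J₁ := by
  ext ⟨j, hj⟩
  cases j with
  | none => rfl
  | some j => rfl

end SupportFabric

theorem restrict₂_image_posOrthant {I : Type u} {J₁ J₂ : Finset I} (h : J₁ ⊆ J₂) :
    (Finset.restrict₂ (π := fun _ => ℝ) h) '' {τ : J₂ → ℝ | ∀ j, 0 ≤ τ j} =
      {τ : J₁ → ℝ | ∀ j, 0 ≤ τ j} := by
  classical
  apply subset_antisymm
  · rintro _ ⟨τ, hτ, rfl⟩ j
    exact hτ _
  · intro τ hτ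
    refine ⟨fun j => if hj : j.1 ∈ J₁ then τ ⟨j.1, hj⟩ else 0, fun j => ?_, ?_⟩
    · by_cases hj : j.1 ∈ J₁
      · simpa [hj] using hτ ⟨j.1, hj⟩
      · simp [hj]
    · ext j
      simp [Finset.restrict₂]

theorem restrict₂_image_posConvexHull {I : Type u} {J₁ J₂ : Finset I} (h : J₁ ⊆ J₂)
    (A : Set (J₂ → ℝ)) :
    Finset.restrict₂ (π := fun _ => ℝ) h '' posConvexHull A =
      posConvexHull (Finset.restrict₂ (π := fun _ => ℝ) h '' A) :=
  image_posConvexHull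
    (f := { toFun := Finset.restrict₂ (π := fun _ => ℝ) h
            map_add' := fun _ _ => rfl
            map_smul' := fun _ _ => rfl })
    (restrict₂_image_posOrthant h) A

theorem smul_posConvexHull {ι : Type*} {c : ℝ} (hc : 0 < c) (A : Set (ι → ℝ)) :
    c • posConvexHull A = posConvexHull (c • A) := by
  refine image_posConvexHull (f := c • LinearMap.id) ?_ A
  apply subset_antisymm
  · rintro _ ⟨τ, hτ, rfl⟩ j
    exact mul_nonneg hc.le (hτ j)
  · intro τ hτ
    refine ⟨c⁻¹ • τ, fun j => mul_nonneg (inv_nonneg.2 hc.le) (hτ j), ?_⟩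
    simp [smul_smul, hc.ne']

theorem image_sub_posConvexHull {ι : Type*} (A : Set (ι → ℝ)) (e : ι → ℝ) :
    (fun σ => σ - e) '' posConvexHull A = posConvexHull ((fun σ => σ - e) '' A) := by
  have h (B : Set (ι → ℝ)) : (fun σ => σ - e) '' B = B + {-e} := by
    simp [Set.add_singleton, sub_eq_add_neg]
  rw [h, h, posConvexHull_eq, posConvexHull_eq, convexHull_add, convexHull_singleton,
    add_right_comm]

namespace PolyhedraSystem

theorem polyhedron_nonneg (D : PolyhedraSystem.{u}) (J : D.fabric.strata) :
    ∀ σ ∈ D.polyhedron J, ∀ j, 0 ≤ σ j := by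
  obtain ⟨A, hA, h⟩ := D.isChar J
  rw [h]
  refine posConvexHull_nonneg fun σ hσ j => ?_
  obtain ⟨n, hn⟩ := hA σ hσ j
  rw [hn]
  positivity

/-- A polyhedra system with denominator `1`. -/
def IsNewton (D : PolyhedraSystem.{u}) : Prop := D.denom = 1

/-- The contact exponent `δ(D) = max {δ(Δ_J) ; J ∈ 𝓗}`, a maximum over a finite set. -/
noncomputable def contactExponent (D : PolyhedraSystem.{u}) : EReal :=
  ⨆ J : D.fabric.strata, (polyhedronContactExponent (D.polyhedron J) : EReal)

/-- The singular locus `Sing(D) = {J ∈ 𝓗 ; δ(Δ_J) ≥ 1}`. -/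
def Sing (D : PolyhedraSystem.{u}) : Set D.fabric.strata :=
  {J | 1 ≤ polyhedronContactExponent (D.polyhedron J)}

/-- The Newton polyhedra system `N(D) = (F; {d Δ_J}, 1)` associated to `D = (F; {Δ_J}, d)`. -/
noncomputable def newton (D : PolyhedraSystem.{u}) : PolyhedraSystem.{u} where
  fabric := D.fabric
  polyhedron J := (D.denom : ℝ) • D.polyhedron J
  denom := 1
  denom_pos := one_pos
  isChar J := by
    have hd : (0 : ℝ) < D.denom := Nat.cast_pos.2 D.denom_pos
    obtain ⟨A, hA, h⟩ := D.isChar J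
    refine ⟨(D.denom : ℝ) • A, ?_, by rw [h, smul_posConvexHull hd]⟩
    rintro _ ⟨σ, hσ, rfl⟩ j
    obtain ⟨n, hn⟩ := hA σ hσ j
    exact ⟨n, by simp [hn, mul_div_cancel₀ _ hd.ne']⟩
  nonempty J := (D.nonempty J).smul_set
  compat J₁ J₂ h := by
    rw [D.compat J₁ J₂ h]
    ext x
    constructor
    · rintro ⟨_, ⟨σ, hσ, rfl⟩, rfl⟩
      exact ⟨_, ⟨σ, hσ, rfl⟩, rfl⟩
    · rintro ⟨_, ⟨σ, hσ, rfl⟩, rfl⟩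
      exact ⟨_, ⟨σ, hσ, rfl⟩, rfl⟩

/-- The polyhedra system `D/d' = (F; {(1/d') Δ_J}, d d')`. -/
noncomputable def divBy (D : PolyhedraSystem.{u}) (d' : ℕ) (hd' : 0 < d') :
    PolyhedraSystem.{u} where
  fabric := D.fabric
  polyhedron J := (1 / (d' : ℝ)) • D.polyhedron J
  denom := D.denom * d'
  denom_pos := Nat.mul_pos D.denom_pos hd'
  isChar J := by
    have hd : (0 : ℝ) < d' := Nat.cast_pos.2 hd'
    obtain ⟨A, hA, h⟩ := D.isChar J
    refine ⟨(1 / (d' : ℝ)) • A, ?_, by rw [h, smul_posConvexHull (by positivity)]⟩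
    rintro _ ⟨σ, hσ, rfl⟩ j
    obtain ⟨n, hn⟩ := hA σ hσ j
    refine ⟨n, ?_⟩
    simp [hn]
    field_simp
  nonempty J := (D.nonempty J).smul_set
  compat J₁ J₂ h := by
    rw [D.compat J₁ J₂ h]
    ext x
    constructor
    · rintro ⟨_, ⟨σ, hσ, rfl⟩, rfl⟩
      exact ⟨_, ⟨σ, hσ, rfl⟩, rfl⟩
    · rintro ⟨_, ⟨σ, hσ, rfl⟩, rfl⟩
      exact ⟨_, ⟨σ, hσ, rfl⟩, rfl⟩

/-- The polyhedra `Δ⁰_{J'}` of the total transform centered in `J`: `[[λ_{J'}(Δ_K)]]` with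
`K = π_J^#(J')` if `∞ ∈ J'`, and `Δ_{J'}` (with relabelled coordinates) if `∞ ∉ J'`. -/
noncomputable def totalPolyhedron (D : PolyhedraSystem.{u}) (J : D.fabric.strata)
    (J' : D.fabric.blowUpStrata J.1) : Set (J'.1 → ℝ) :=
  if none ∈ (J' : Finset (Option D.fabric.I)) then
    posConvexHull (D.fabric.blowUpLin J J' ''
      D.polyhedron ⟨D.fabric.blowUpMap J J', D.fabric.blowUpMap_mem J'.2⟩)
  else
    D.fabric.blowUpLin J J' ''
      D.polyhedron ⟨D.fabric.blowUpMap J J', D.fabric.blowUpMap_mem J'.2⟩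

/-- The polyhedra `Δ'_{J'} = Δ⁰_{J'} - e_{J',∞}` of the characteristic transform. -/
noncomputable def charPolyhedron (D : PolyhedraSystem.{u}) (J : D.fabric.strata)
    (J' : D.fabric.blowUpStrata J.1) : Set (J'.1 → ℝ) :=
  (fun σ => σ - SupportFabric.eInfty (J' : Finset (Option D.fabric.I))) '' D.totalPolyhedron J J'

theorem totalPolyhedron_eq_aux (D : PolyhedraSystem.{u}) (J : D.fabric.strata)
    (J' : D.fabric.blowUpStrata J.1)
    (A : Set (D.fabric.blowUpMap (J : Finset D.fabric.I) J' → ℝ))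
    (hA : D.polyhedron ⟨D.fabric.blowUpMap J J', D.fabric.blowUpMap_mem J'.2⟩ =
      posConvexHull A) :
    D.totalPolyhedron J J' = posConvexHull (D.fabric.blowUpLin J J' '' A) := by
  unfold totalPolyhedron
  rw [hA]
  split_ifs with hn
  · exact posConvexHull_image_posConvexHull (D.fabric.blowUpLinearMap J J')
      (D.fabric.blowUpLin_nonneg J J') A
  · refine image_posConvexHull (D.fabric.blowUpLinearMap J J') ?_ A
    apply subset_antisymm
    · rintro _ ⟨τ, hτ, rfl⟩
      exact D.fabric.blowUpLin_nonneg J J' τ hτ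
    · intro τ hτ
      have key : ∀ i, i ∈ D.fabric.blowUpMap (J : Finset D.fabric.I) J' →
          some i ∈ (J' : Finset (Option D.fabric.I)) := by
        intro i hi
        rw [SupportFabric.blowUpMap, if_neg hn] at hi
        exact Finset.mem_eraseNone.1 hi
      refine ⟨fun i => τ ⟨some i.1, key i.1 i.2⟩, fun i => hτ _, ?_⟩
      ext ⟨j, hj⟩
      cases j with
      | none => exact absurd hj hn
      | some j => rfl

theorem totalPolyhedron_compat (D : PolyhedraSystem.{u}) (J : D.fabric.strata)
    (J₁ J₂ : D.fabric.blowUpStrata J.1)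
    (h : (J₁ : Finset (Option D.fabric.I)) ⊆ (J₂ : Finset (Option D.fabric.I))) :
    D.totalPolyhedron J J₁ =
      Finset.restrict₂ (π := fun _ => ℝ) h '' D.totalPolyhedron J J₂ := by
  obtain ⟨A, -, hA⟩ :=
    D.isChar ⟨D.fabric.blowUpMap J J₂, D.fabric.blowUpMap_mem J₂.2⟩
  have hA₁ := D.compat ⟨D.fabric.blowUpMap J J₁, D.fabric.blowUpMap_mem J₁.2⟩
    ⟨D.fabric.blowUpMap J J₂, D.fabric.blowUpMap_mem J₂.2⟩ (D.fabric.blowUpMap_mono h)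
  rw [hA, restrict₂_image_posConvexHull] at hA₁
  rw [D.totalPolyhedron_eq_aux J J₁ _ hA₁, D.totalPolyhedron_eq_aux J J₂ _ hA]
  refine Eq.trans ?_ (restrict₂_image_posConvexHull (I := Option D.fabric.I) h _).symm
  rw [Set.image_image, Set.image_image]
  exact congrArg _ (Set.image_congr fun σ _ => D.fabric.blowUpLin_restrict J h σ)

/-- If `J` is singular, then `∑_{j ∈ J} σ(j) ≥ 1` on each `Δ_K` with `K ⊇ J`. -/
theorem one_le_sum_of_mem_sing (D : PolyhedraSystem.{u}) (J K : D.fabric.strata)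
    (hJ : J ∈ D.Sing) (h : (J : Finset D.fabric.I) ⊆ (K : Finset D.fabric.I)) (σ : K.1 → ℝ)
    (hσ : σ ∈ D.polyhedron K) :
    1 ≤ ∑ j : (J : Finset D.fabric.I), σ ⟨j, h j.2⟩ := by
  have h1 : 1 ≤ polyhedronContactExponent (D.polyhedron J) := hJ
  unfold polyhedronContactExponent at h1
  split_ifs at h1 with h0
  · norm_num at h1
  · refine h1.trans (csInf_le ⟨0, ?_⟩ ?_)
    · rintro _ ⟨τ, hτ, rfl⟩
      exact Finset.sum_nonneg fun j _ => D.polyhedron_nonneg J τ hτ j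
    · refine ⟨Finset.restrict₂ (π := fun _ => ℝ) h σ, ?_, rfl⟩
      rw [D.compat J K h]
      exact ⟨σ, hσ, rfl⟩

theorem charPolyhedron_isChar (D : PolyhedraSystem.{u}) (J : D.fabric.strata)
    (hJ : J ∈ D.Sing) (J' : D.fabric.blowUpStrata J.1) :
    IsCharPolyhedron D.denom (D.charPolyhedron J J') := by
  have hd : (0 : ℝ) < D.denom := Nat.cast_pos.2 D.denom_pos
  obtain ⟨A, hA, hAΔ⟩ :=
    D.isChar ⟨D.fabric.blowUpMap J J', D.fabric.blowUpMap_mem J'.2⟩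
  refine ⟨_, ?_, by
    rw [charPolyhedron, D.totalPolyhedron_eq_aux J J' A hAΔ, image_sub_posConvexHull]⟩
  rintro _ ⟨_, ⟨σ, hσ, rfl⟩, rfl⟩ ⟨j, hj⟩
  cases j with
  | some j =>
    obtain ⟨n, hn⟩ := hA σ hσ ⟨j, D.fabric.mem_blowUpMap_of_some hj⟩
    exact ⟨n, by simpa [SupportFabric.blowUpLin, SupportFabric.eInfty] using hn⟩
  | none =>
    have hsum := D.one_le_sum_of_mem_sing J
      ⟨D.fabric.blowUpMap J J', D.fabric.blowUpMap_mem J'.2⟩ hJ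
      (D.fabric.subset_blowUpMap hj) σ (by rw [hAΔ]; exact subset_posConvexHull A hσ)
    choose n hn using hA σ hσ
    have hs : ∑ j : (J : Finset D.fabric.I), σ ⟨j, D.fabric.subset_blowUpMap hj j.2⟩ =
        ((∑ j : (J : Finset D.fabric.I),
          n ⟨j, D.fabric.subset_blowUpMap hj j.2⟩ : ℕ) : ℝ) / D.denom := by
      rw [Nat.cast_sum, Finset.sum_div]
      exact Finset.sum_congr rfl fun j _ => hn _
    rw [hs, le_div_iff₀ hd, one_mul, Nat.cast_le] at hsum
    refine ⟨(∑ j : (J : Finset D.fabric.I), n ⟨j, D.fabric.subset_blowUpMap hj j.2⟩) -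
      D.denom, ?_⟩
    rw [Nat.cast_sub hsum, sub_div, div_self hd.ne', ← hs]
    rfl

theorem charPolyhedron_nonempty (D : PolyhedraSystem.{u}) (J : D.fabric.strata)
    (J' : D.fabric.blowUpStrata J.1) : (D.charPolyhedron J J').Nonempty := by
  refine Set.Nonempty.image _ ?_
  have h := (D.nonempty ⟨D.fabric.blowUpMap J J', D.fabric.blowUpMap_mem J'.2⟩).image
    (D.fabric.blowUpLin J J')
  unfold totalPolyhedron
  split_ifs
  · exact h.mono (subset_posConvexHull _)
  · exact h

theorem charPolyhedron_compat (D : PolyhedraSystem.{u}) (J : D.fabric.strata)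
    (J₁ J₂ : D.fabric.blowUpStrata J.1)
    (h : (J₁ : Finset (Option D.fabric.I)) ⊆ (J₂ : Finset (Option D.fabric.I))) :
    D.charPolyhedron J J₁ =
      Finset.restrict₂ (π := fun _ => ℝ) h '' D.charPolyhedron J J₂ := by
  rw [charPolyhedron, charPolyhedron, D.totalPolyhedron_compat J J₁ J₂ h, Set.image_image,
    Set.image_image]
  refine Set.image_congr fun σ _ => ?_
  rw [← SupportFabric.eInfty_restrict h]
  rfl

/-- The characteristic transform `Λ_J(D)` of `D` centered in `J ∈ Sing(D)`. -/
noncomputable def charTransform (D : PolyhedraSystem.{u}) (J : D.fabric.strata)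
    (hJ : J ∈ D.Sing) : PolyhedraSystem.{u} where
  fabric := D.fabric.blowUp J
  polyhedron := D.charPolyhedron J
  denom := D.denom
  denom_pos := D.denom_pos
  isChar := D.charPolyhedron_isChar J hJ
  nonempty := D.charPolyhedron_nonempty J
  compat := D.charPolyhedron_compat J

/-- The `d`-moderated transform `Θ^d_J(N) = N(Λ_J(N/d))`, for `J ∈ Sing(N/d)`. -/
noncomputable def moderatedTransform (N : PolyhedraSystem.{u}) (d : ℕ) (hd : 0 < d)
    (J : (N.divBy d hd).fabric.strata) (hJ : J ∈ (N.divBy d hd).Sing) : PolyhedraSystem.{u} :=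
  ((N.divBy d hd).charTransform J hJ).newton

/-- `N'` is a `d`-moderated transform of `N`, centered in some `J ∈ Sing(N/d)`. -/
def IsModeratedTransform (d : ℕ) (hd : 0 < d) (N N' : PolyhedraSystem.{u}) : Prop :=
  ∃ (J : (N.divBy d hd).fabric.strata) (hJ : J ∈ (N.divBy d hd).Sing),
    N' = N.moderatedTransform d hd J hJ

end PolyhedraSystem

/-! A Newton polyhedra system is generated, on all strata at once, by the natural weights on `I`
whose restriction to every stratum `K` lies in `Δ_K` (`exists_extension`,
`IsNewton.exists_generatedBy`). In these terms a moderated transform gives the new index the weight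
`∑_J w - d`, and `δ < d` holds once every stratum carries a weight of total less than `d`. It thus
suffices to empty the singular locus of a weighted fabric, which is a combinatorial resolution by
maximal contact.

The induction is on the largest size of a stratum, over all non-empty families with bounded positive
thresholds (`resolvable_of_dimLE`). After scaling to one threshold `d`, write the weights as `m +
b_s` with `m` common, and let `μ` be such that each singular stratum has some `b_s` of total at most
`μ`. If `μ = 0`, some weight equals `m` on each singular stratum, and blowing up minimal singular
strata is enough (`Monomial.resolvable`).

If `μ > 0`, adjoin the `b_s` with threshold `μ`. On each singular stratum of the enlarged family
some `b_s` has total exactly `μ`, and it acts as maximal contact: exceptional indices get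
`b_s`-weight zero, so only the old indices have to be removed from the singular strata. Those
through an index `j` are governed by the link of `j`, which has smaller strata and thresholds
lowered by the weights of `j` (`Controlled.resolvable`). Emptying this locus lowers `μ`
(`CommonPart.resolvable`). -/

/-! ### Weighted fabrics and their blow-ups. -/

/-- A support fabric together with a family of natural weights on its index set. -/
structure WeightedFabric (α : Type u) where
  fabric : SupportFabric.{u}
  weight : α → fabric.I → ℕ

namespace WeightedFabric

variable {α β : Type u}

/-- The strata on which every weight of the family has total at least its threshold. -/
def singular (P : WeightedFabric α) (d : α → ℕ) : Set (Finset P.fabric.I) :=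
  {J | J ∈ P.fabric.strata ∧ ∀ s, d s ≤ ∑ j ∈ J, P.weight s j}

/-- The blow-up centered in `J`: the new index has weight `∑_J w - d`. -/
def blowUp (P : WeightedFabric α) (d : α → ℕ) (J : Finset P.fabric.I) : WeightedFabric α where
  fabric := P.fabric.blowUp J
  weight s := fun o : Option P.fabric.I => o.elim (∑ j ∈ J, P.weight s j - d s) (P.weight s)

/-- `Q` is the blow-up of `P` in a non-empty singular stratum. -/
def Step (d : α → ℕ) (P Q : WeightedFabric α) : Prop :=
  ∃ J ∈ P.singular d, J.Nonempty ∧ Q = P.blowUp d J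

/-- `Q` is obtained from `P` by finitely many blow-ups in non-empty singular strata. -/
def Reach (d : α → ℕ) : WeightedFabric α → WeightedFabric α → Prop :=
  Relation.ReflTransGen (Step d)

/-- Finitely many blow-ups in singular strata make the singular locus empty. -/
def Resolvable (d : α → ℕ) (P : WeightedFabric α) : Prop :=
  ∃ Q, Reach d P Q ∧ Q.singular d = ∅

/-- All strata have at most `n` elements. -/
def DimLE (P : WeightedFabric α) (n : ℕ) : Prop := ∀ K ∈ P.fabric.strata, K.card ≤ n

theorem Resolvable.of_reach {d : α → ℕ} {P Q : WeightedFabric α} (h : Reach d P Q)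
    (hQ : Resolvable d Q) : Resolvable d P := by
  obtain ⟨R, hR, h0⟩ := hQ
  exact ⟨R, h.trans hR, h0⟩

theorem sum_blowUp_map_some (P : WeightedFabric α) (d : α → ℕ) (J L : Finset P.fabric.I) (s : α) :
    ∑ i ∈ (L.map Function.Embedding.some : Finset (Option P.fabric.I)),
      (P.blowUp d J).weight s i = ∑ i ∈ L, P.weight s i :=
  Finset.sum_map L Function.Embedding.some ((P.blowUp d J).weight s)

theorem sum_insertNone_weight {ι : Type*} (f : Option ι → ℕ) (L : Finset ι) :
    ∑ i ∈ Finset.insertNone L, f i = f none + ∑ i ∈ L, f (some i) := by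
  simp

theorem sum_exceptional {ι : Type*} [DecidableEq ι] (f : Option ι → ℕ) {J K A : Finset ι}
    (hA : A ⊆ J) :
    ∑ i ∈ Finset.insertNone ((K \ J) ∪ A), f i =
      f none + (∑ i ∈ K \ J, f (some i) + ∑ i ∈ A, f (some i)) := by
  rw [sum_insertNone_weight, Finset.sum_union]
  exact Finset.disjoint_of_subset_right hA Finset.sdiff_disjoint

theorem singular_mono {P : WeightedFabric α} {d : α → ℕ} {J K : Finset P.fabric.I}
    (hJ : J ∈ P.singular d) (hK : K ∈ P.fabric.strata) (h : J ⊆ K) : K ∈ P.singular d :=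
  ⟨hK, fun s => (hJ.2 s).trans (Finset.sum_le_sum_of_subset h)⟩

/-- A singular stratum of a blow-up lies over a singular stratum. -/
theorem singular_blowUp_cases {P : WeightedFabric α} {d : α → ℕ} {J : Finset P.fabric.I}
    (hJ : J ∈ P.singular d) {K' : Finset (Option P.fabric.I)}
    (hK' : K' ∈ (P.blowUp d J).singular d) :
    (∃ L ∈ P.singular d, ¬ J ⊆ L ∧ K' = L.map Function.Embedding.some) ∨
    (∃ K ∈ P.singular d, J ⊆ K ∧ ∃ A, A ⊂ J ∧ K' = Finset.insertNone ((K \ J) ∪ A)) := by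
  rcases hK' with ⟨⟨L, hL, hJL, rfl⟩ | ⟨K, hK, hJK, A, hA, rfl⟩, h⟩
  · refine Or.inl ⟨L, ⟨hL, fun s => ?_⟩, hJL, rfl⟩
    exact (h s).trans (P.sum_blowUp_map_some d J L s).le
  · exact Or.inr ⟨K, singular_mono hJ hK hJK, hJK, A, hA, rfl⟩

/-- `A` misses at least one index of `J`, which makes room for the new index. -/
theorem DimLE.blowUp {P : WeightedFabric α} {n : ℕ} (h : P.DimLE n) (d : α → ℕ)
    (J : Finset P.fabric.I) : (P.blowUp d J).DimLE n := by
  rintro K' (⟨L, hL, -, rfl⟩ | ⟨K, hK, hJK, A, hA, rfl⟩)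
  · exact (Finset.card_map _).trans_le (h L hL)
  · have h1 := h K hK
    have h2 := Finset.card_lt_card hA
    have h3 := Finset.card_sdiff_add_card_eq_card hJK
    have h4 := Finset.card_union_le (K \ J) A
    refine (Finset.card_insertNone _).le.trans ?_
    omega

theorem DimLE.reach {P Q : WeightedFabric α} {n : ℕ} {d : α → ℕ} (h : P.DimLE n)
    (hQ : Reach d P Q) : Q.DimLE n := by
  induction hQ with
  | refl => exact h
  | tail _ hs ih =>
    obtain ⟨J, -, -, rfl⟩ := hs
    exact ih.blowUp d J

/-! ### Change of the family -/

/-- Reindexing of the family of weights. -/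
def comap (P : WeightedFabric α) (f : β → α) : WeightedFabric β := ⟨P.fabric, fun s => P.weight (f s)⟩

/-- A reindexed family imposes no new condition on a center. -/
theorem Reach.comap {d : α → ℕ} {P Q : WeightedFabric α} (h : Reach d P Q) (f : β → α) :
    Reach (fun s => d (f s)) (P.comap f) (Q.comap f) := by
  induction h with
  | refl => exact .refl
  | tail _ hs ih =>
    obtain ⟨J, hJ, hne, rfl⟩ := hs
    exact ih.tail ⟨J, ⟨hJ.1, fun s => hJ.2 (f s)⟩, hne, rfl⟩

/-- Multiplication of each weight by a constant. -/
def scale (P : WeightedFabric α) (c : α → ℕ) : WeightedFabric α :=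
  ⟨P.fabric, fun s i => c s * P.weight s i⟩

theorem singular_scale (P : WeightedFabric α) {c d : α → ℕ} (hc : ∀ s, 0 < c s) :
    (P.scale c).singular (fun s => c s * d s) = P.singular d := by
  refine Set.ext fun J : Finset P.fabric.I => and_congr Iff.rfl (forall_congr' fun s => ?_)
  change c s * d s ≤ ∑ j ∈ J, c s * P.weight s j ↔ _
  rw [← Finset.mul_sum]
  exact Nat.mul_le_mul_left_iff (hc s)

theorem blowUp_scale (P : WeightedFabric α) (c d : α → ℕ) (J : Finset P.fabric.I) :
    (P.scale c).blowUp (fun s => c s * d s) J = (P.blowUp d J).scale c := by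
  refine congrArg (WeightedFabric.mk (P.fabric.blowUp J)) ?_
  funext s o
  cases o with
  | none =>
    change ∑ j ∈ J, c s * P.weight s j - c s * d s = c s * (∑ j ∈ J, P.weight s j - d s)
    rw [← Finset.mul_sum, Nat.mul_sub]
  | some i => rfl

/-- Scaling by positive constants commutes with blowing up and keeps the singular locus, so a
sequence for the scaled fabric is the scaling of a sequence for `P`. -/
theorem Resolvable.of_scale {P : WeightedFabric α} {c d : α → ℕ} (hc : ∀ s, 0 < c s)
    (h : Resolvable (fun s => c s * d s) (P.scale c)) : Resolvable d P := by
  obtain ⟨Q', hQ', h0⟩ := h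
  suffices ∃ Q, Reach d P Q ∧ Q' = Q.scale c by
    obtain ⟨Q, hQ, rfl⟩ := this
    exact ⟨Q, hQ, by rwa [singular_scale Q hc] at h0⟩
  clear h0
  induction hQ' with
  | refl => exact ⟨P, .refl, rfl⟩
  | tail _ hs ih =>
    obtain ⟨Q, hQ, rfl⟩ := ih
    obtain ⟨J, hJ, hne, rfl⟩ := hs
    rw [singular_scale Q hc] at hJ
    exact ⟨Q.blowUp d J, hQ.tail ⟨J, hJ, hne, rfl⟩, blowUp_scale Q c d J⟩

/-! ### Links -/

/-- The strata `K` with `j ∉ K` and `K ∪ {j}` a stratum. -/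
def _root_.SupportFabric.link (F : SupportFabric.{u}) (j : F.I) : SupportFabric.{u} where
  I := F.I
  strata := {K | j ∉ K ∧ insert j K ∈ F.strata}
  isOpen _ hK _ h := ⟨fun hj => hK.1 (h hj), F.isOpen _ hK.2 _ (Finset.insert_subset_insert _ h)⟩

/-- The strata of the blow-up of a set of subsets of `ι`. -/
def blowUpSet {ι : Type*} [DecidableEq ι] (H : Set (Finset ι)) (J : Finset ι) :
    Set (Finset (Option ι)) :=
  {J' | ∃ L ∈ H, ¬ J ⊆ L ∧ J' = L.map Function.Embedding.some} ∪
  {J' | ∃ K ∈ H, J ⊆ K ∧ ∃ A, A ⊂ J ∧ J' = Finset.insertNone ((K \ J) ∪ A)}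

/-- A stratum through the old index `j` comes either from some `L` containing `j`, which then cannot
contain `J`, or from some `A` containing `j`. Erasing `j` gives the two kinds of strata in the
blow-up of the link. -/
theorem mem_blowUpSet_link {ι : Type*} [DecidableEq ι] (H : Set (Finset ι)) {j : ι}
    {J : Finset ι} (hj : j ∉ J) (K' : Finset (Option ι)) :
    (some j ∉ K' ∧ insert (some j) K' ∈ blowUpSet H (insert j J)) ↔
      K' ∈ blowUpSet {K | j ∉ K ∧ insert j K ∈ H} J := by
  constructor
  · rintro ⟨hjK, ⟨L, hL, hJL, h⟩ | ⟨K, hK, hJK, A, hA, h⟩⟩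
    · have hmem : ∀ x, x ∈ insert (some j) K' ↔ x ∈ L.map Function.Embedding.some := by simp [h]
      have hjL : j ∈ L := by simpa using hmem (some j)
      refine Or.inl ⟨L.erase j, ⟨by simp, by rwa [Finset.insert_erase hjL]⟩, fun h' => hJL ?_, ?_⟩
      · exact Finset.insert_subset hjL (h'.trans (Finset.erase_subset _ _))
      · rw [← Finset.erase_insert hjK, h]
        ext x
        cases x <;> simp
    · have hmem : ∀ x, x ∈ insert (some j) K' ↔
          x ∈ Finset.insertNone ((K \ insert j J) ∪ A) := by simp [h]
      have hjA : j ∈ A := by simpa using hmem (some j)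
      have hjK' : j ∈ K := hJK (Finset.mem_insert_self _ _)
      refine Or.inr ⟨K.erase j, ⟨by simp, by rwa [Finset.insert_erase hjK']⟩, ?_, A.erase j,
        ⟨?_, ?_⟩, ?_⟩
      · exact Finset.subset_erase.2 ⟨(Finset.subset_insert _ _).trans hJK, hj⟩
      · exact (Finset.erase_subset_erase j hA.1).trans (Finset.erase_insert hj).subset
      · exact fun h' => hA.2 (Finset.insert_subset hjA (h'.trans (Finset.erase_subset _ _)))
      · rw [← Finset.erase_insert hjK, h]
        ext x
        cases x with
        | none => simp
        | some x =>
          have : x = j → x ∉ J := by rintro rfl; exact hj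
          simp
          tauto
  · rintro (⟨L, ⟨hjL, hL⟩, hJL, rfl⟩ | ⟨K, ⟨hjK, hK⟩, hJK, A, hA, rfl⟩)
    · refine ⟨fun h => hjL (by simpa using h), Or.inl ⟨insert j L, hL, fun h => hJL ?_, ?_⟩⟩
      · exact (Finset.insert_subset_insert_iff hj).1 h
      · exact (Finset.map_insert _ _ _).symm
    · have hjA : j ∉ A := fun h => hj (hA.1 h)
      refine ⟨fun h => ?_, Or.inr ⟨insert j K, hK, Finset.insert_subset_insert _ hJK,
        insert j A, ⟨Finset.insert_subset_insert _ hA.1, fun h => hA.2 ?_⟩, ?_⟩⟩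
      · have h' : (j ∈ K ∧ j ∉ J) ∨ j ∈ A := by simpa using h
        exact h'.elim (fun h => hjK h.1) hjA
      · exact (Finset.insert_subset_insert_iff hj).1 h
      · ext x
        cases x with
        | none => simp
        | some x =>
          have : x = j → x ∉ J := by rintro rfl; exact hj
          have : x = j → x ∉ K := by rintro rfl; exact hjK
          simp
          tauto

/-- The link at `j`, with the subfamily of weights selected by `f`. -/
def link (P : WeightedFabric α) (f : β → α) (j : P.fabric.I) : WeightedFabric β :=
  ⟨P.fabric.link j, fun s => P.weight (f s)⟩

/-! ### Controlled families: maximal contact and descent to links. -/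

/-- On each singular stratum some weight selected by `p` attains at most its threshold and is
supported in `T`. -/
def Controlled (P : WeightedFabric α) (d : α → ℕ) (p : α → Prop) (T : Finset P.fabric.I) : Prop :=
  ∀ K ∈ P.singular d, ∃ s, p s ∧ ∑ i ∈ K, P.weight s i ≤ d s ∧ ∀ i ∈ K, i ∉ T → P.weight s i = 0

/-- If `s` controls a stratum `K ⊇ J`, then `d s ≤ ∑_J ≤ ∑_K ≤ d s`, so the new index has `s`-weight
zero. Hence `T` need not acquire the new index and keeps its cardinality. -/
theorem Controlled.blowUp {P : WeightedFabric α} {d : α → ℕ} {p : α → Prop}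
    {T J : Finset P.fabric.I} (h : P.Controlled d p T) (hJ : J ∈ P.singular d) :
    (P.blowUp d J).Controlled d p (T.map Function.Embedding.some : Finset (Option P.fabric.I)) := by
  intro K' hK'
  rcases singular_blowUp_cases hJ hK' with ⟨L, hL, -, rfl⟩ | ⟨K, hK, hJK, A, hA, rfl⟩
  · obtain ⟨s, hp, hs, h0⟩ := h L hL
    refine ⟨s, hp, (P.sum_blowUp_map_some d J L s).trans_le hs, ?_⟩
    intro i hi hiT
    obtain ⟨i, hi', rfl⟩ := Finset.mem_map.1 hi
    exact h0 i hi' fun hT => hiT (Finset.mem_map_of_mem _ hT)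
  · obtain ⟨s, hp, hs, h0⟩ := h K hK
    have h1 := hJ.2 s
    have h2 : ∑ i ∈ K \ J, P.weight s i + ∑ i ∈ J, P.weight s i = ∑ i ∈ K, P.weight s i :=
      Finset.sum_sdiff hJK
    have h3 : ∑ i ∈ A, P.weight s i ≤ ∑ i ∈ J, P.weight s i :=
      Finset.sum_le_sum_of_subset hA.1
    refine ⟨s, hp, (sum_exceptional _ hA.1).trans_le ?_, ?_⟩
    · change (∑ i ∈ J, P.weight s i - d s) +
        (∑ i ∈ K \ J, P.weight s i + ∑ i ∈ A, P.weight s i) ≤ d s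
      omega
    · rintro (_ | i) hi hiT
      · change ∑ i ∈ J, P.weight s i - d s = 0
        omega
      · have hi' : i ∈ K \ J ∪ A := Finset.some_mem_insertNone.1 hi
        refine h0 i ?_ fun hT => hiT (Finset.mem_map_of_mem _ hT)
        exact (Finset.mem_union.1 hi').elim (fun h => (Finset.mem_sdiff.1 h).1)
          fun h => hJK (hA.1 h)

theorem Controlled.reach {P Q : WeightedFabric α} {d : α → ℕ} {p : α → Prop}
    {T : Finset P.fabric.I} (h : P.Controlled d p T) (hQ : Reach d P Q) :
    ∃ T', Q.Controlled d p T' := by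
  induction hQ with
  | refl => exact ⟨T, h⟩
  | tail _ hs ih =>
    obtain ⟨T', h'⟩ := ih
    obtain ⟨J, hJ, -, rfl⟩ := hs
    exact ⟨_, h'.blowUp hJ⟩

/-- Compares weighted fabrics over one index type without transporting weights along an equality of
fabrics. -/
theorem mk_eq_mk {I : Type u} [Fintype I] [DecidableEq I] {H₁ H₂ : Set (Finset I)}
    {h₁ : ∀ J ∈ H₁, ∀ J' ⊆ J, J' ∈ H₁} {h₂ : ∀ J ∈ H₂, ∀ J' ⊆ J, J' ∈ H₂} {w₁ w₂ : α → I → ℕ}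
    (hH : H₁ = H₂) (hw : w₁ = w₂) :
    (⟨⟨I, H₁, h₁⟩, w₁⟩ : WeightedFabric α) = ⟨⟨I, H₂, h₂⟩, w₂⟩ := by
  subst hH hw
  rfl

/-- The link of a blow-up centered in `J ∪ {j}` is the blow-up of the link centered in `J`. -/
theorem link_blowUp (P : WeightedFabric α) {d : α → ℕ} {f : β → α} {j : P.fabric.I}
    (hf : ∀ s, P.weight (f s) j ≤ d (f s)) {J : Finset P.fabric.I} (hj : j ∉ J) :
    (P.blowUp d (insert j J)).link f (some j : Option P.fabric.I) =
      (P.link f j).blowUp (fun s => d (f s) - P.weight (f s) j) J := by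
  refine mk_eq_mk (I := Option P.fabric.I)
    (Set.ext (mem_blowUpSet_link P.fabric.strata hj)) ?_
  funext s o
  cases o with
  | some i => rfl
  | none =>
    change ∑ i ∈ insert j J, P.weight (f s) i - d (f s) =
      ∑ i ∈ J, P.weight (f s) i - (d (f s) - P.weight (f s) j)
    have := hf s
    rw [Finset.sum_insert hj]
    omega

/-- A sequence of blow-ups of the link at `j` lifts. -/
theorem Controlled.exists_reach_of_reach_link {d c : α → ℕ} {p : α → Prop} {P : WeightedFabric α}
    {T : Finset P.fabric.I} (h : P.Controlled d p T) {j : P.fabric.I} (hj : j ∈ T)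
    (hc : ∀ s, P.weight s j = c s) {Q : WeightedFabric {s // c s < d s}}
    (hQ : Reach (fun s : {s // c s < d s} => d s - c s) (P.link Subtype.val j) Q) :
    ∃ (P' : WeightedFabric α) (T' : Finset P'.fabric.I) (j' : P'.fabric.I), Reach d P P' ∧
      P'.Controlled d p T' ∧ T'.card = T.card ∧ j' ∈ T' ∧ (∀ s, P'.weight s j' = c s) ∧
      P'.link Subtype.val j' = Q := by
  induction hQ with
  | refl => exact ⟨P, T, j, .refl, h, rfl, hj, hc, rfl⟩
  | tail _ hs ih =>
    obtain ⟨P', T', j', hP', h', hT', hj', hc', rfl⟩ := ih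
    obtain ⟨(J : Finset P'.fabric.I), hJ, -, rfl⟩ := hs
    have hjJ : j' ∉ J := hJ.1.1
    have hsing : insert j' J ∈ P'.singular d := by
      refine ⟨hJ.1.2, fun s => ?_⟩
      rw [Finset.sum_insert hjJ, hc']
      -- Weights with `d s ≤ c s` are absent from the link family, but for them `j'` alone reaches
      -- the threshold.
      by_cases hs : c s < d s
      · have h1 : d s - c s ≤ ∑ i ∈ J, P'.weight s i := hJ.2 ⟨s, hs⟩
        omega
      · omega
    refine ⟨P'.blowUp d (insert j' J),
      (T'.map Function.Embedding.some : Finset (Option P'.fabric.I)), some j',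
      hP'.tail ⟨_, hsing, Finset.insert_nonempty _ _, rfl⟩, h'.blowUp hsing,
      (Finset.card_map _).trans hT', Finset.mem_map_of_mem _ hj', hc', ?_⟩
    refine (P'.link_blowUp (f := Subtype.val) (fun s => (hc' s).trans_le s.2.le) hjJ).trans ?_
    simp only [hc']

/-- If links can be resolved, then the strata containing a given index can be made
non-singular. -/
theorem Controlled.exists_reach_forall_notMem {n : ℕ}
    (ih : ∀ {β : Type u} [Nonempty β] (d : β → ℕ), (∀ s, 0 < d s) → BddAbove (Set.range d) →
      ∀ Q : WeightedFabric β, Q.DimLE n → Resolvable d Q)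
    {d : α → ℕ} (hB : BddAbove (Set.range d)) {p : α → Prop} {P : WeightedFabric α}
    (hn : P.DimLE (n + 1)) {T : Finset P.fabric.I} (h : P.Controlled d p T) {j : P.fabric.I}
    (hj : j ∈ T) :
    ∃ (P' : WeightedFabric α) (T' : Finset P'.fabric.I) (j' : P'.fabric.I), Reach d P P' ∧
      P'.Controlled d p T' ∧ T'.card = T.card ∧ j' ∈ T' ∧ ∀ K ∈ P'.singular d, j' ∉ K := by
  by_cases he : ∃ s, P.weight s j < d s
  · have : Nonempty {s // P.weight s j < d s} := he.elim fun s hs => ⟨⟨s, hs⟩⟩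
    obtain ⟨Q, hQ, h0⟩ := ih (β := {s // P.weight s j < d s}) (fun s => d s - P.weight s j)
      (fun s => Nat.sub_pos_of_lt s.2) (by
        obtain ⟨B, hB⟩ := hB
        refine ⟨B, ?_⟩
        rintro _ ⟨s, rfl⟩
        exact (Nat.sub_le _ _).trans (hB ⟨s, rfl⟩)) (P.link Subtype.val j) (by
        rintro K ⟨hjK, hK⟩
        exact Nat.le_of_succ_le_succ ((Finset.card_insert_of_notMem hjK).symm.trans_le (hn _ hK)))
    obtain ⟨P', T', j', hP', h', hT', hj', hc', rfl⟩ :=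
      h.exists_reach_of_reach_link hj (fun s => rfl) hQ
    refine ⟨P', T', j', hP', h', hT', hj', fun K hK hjK => ?_⟩
    rw [Set.eq_empty_iff_forall_notMem] at h0
    -- A singular stratum through `j'` would leave a singular stratum in the resolved link.
    refine h0 (K.erase j') ⟨⟨Finset.notMem_erase _ _, ?_⟩, fun s => ?_⟩
    · rw [Finset.insert_erase hjK]
      exact hK.1
    · have h1 := hK.2 s.1
      rw [← Finset.add_sum_erase _ _ hjK, hc'] at h1
      exact Nat.sub_le_iff_le_add'.2 h1
  · push Not at he
    -- Here `j` alone reaches every threshold and the link family would be empty. Blowing up `{j}`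
    -- removes `j` from all strata, because the only proper subset of `{j}` is empty.
    by_cases hs : {j} ∈ P.fabric.strata
    · have hsing : {j} ∈ P.singular d := ⟨hs, fun s => by simpa using he s⟩
      refine ⟨P.blowUp d {j}, (T.map Function.Embedding.some : Finset (Option P.fabric.I)), some j,
        .single ⟨_, hsing, Finset.singleton_nonempty _, rfl⟩, h.blowUp hsing,
        Finset.card_map _, Finset.mem_map_of_mem _ hj, fun K' hK' hjK => ?_⟩
      rcases singular_blowUp_cases hsing hK' with ⟨L, hL, hjL, rfl⟩ | ⟨K, hK, hJK, A, hA, rfl⟩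
      · exact hjL (by simpa using (Finset.mem_map' Function.Embedding.some).1 hjK)
      · have h1 := Finset.some_mem_insertNone.1 hjK
        rw [Finset.ssubset_singleton_iff.1 hA] at h1
        simp at h1
    · exact ⟨P, T, j, .refl, h, rfl, hj, fun K hK hjK =>
        hs (P.fabric.isOpen K hK.1 _ (Finset.singleton_subset_iff.2 hjK))⟩

/-- Induction on the size of `T`: an index lying in no singular stratum can be erased from `T`. For
`T = ∅` a controlling weight has total zero on a singular stratum, against its positive threshold.
-/
theorem Controlled.resolvable {n : ℕ}
    (ih : ∀ {β : Type u} [Nonempty β] (d : β → ℕ), (∀ s, 0 < d s) → BddAbove (Set.range d) →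
      ∀ Q : WeightedFabric β, Q.DimLE n → Resolvable d Q)
    {d : α → ℕ} (hd : ∀ s, 0 < d s) (hB : BddAbove (Set.range d)) {p : α → Prop}
    {P : WeightedFabric α} (hn : P.DimLE (n + 1)) {T : Finset P.fabric.I}
    (h : P.Controlled d p T) : Resolvable d P := by
  induction hm : T.card generalizing P with
  | zero =>
    refine ⟨P, .refl, Set.eq_empty_iff_forall_notMem.2 fun K hK => ?_⟩
    obtain ⟨s, -, -, h0⟩ := h K hK
    have h1 := hK.2 s
    rw [Finset.sum_eq_zero fun i hi => h0 i hi (by simp [Finset.card_eq_zero.1 hm])] at h1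
    exact (hd s).not_ge h1
  | succ m ihm =>
    obtain ⟨j, hj⟩ := Finset.card_pos.1 (by omega : 0 < T.card)
    obtain ⟨P', T', j', hP', h', hT', hj', h0⟩ := h.exists_reach_forall_notMem ih hB hn hj
    refine .of_reach hP' (ihm (hn.reach hP') (T := T'.erase j') (fun K hK => ?_) ?_)
    · obtain ⟨s, hp, hs, h1⟩ := h' K hK
      refine ⟨s, hp, hs, fun i hi hiT => h1 i hi fun hi' => hiT ?_⟩
      exact Finset.mem_erase.2 ⟨fun e => h0 K hK (e ▸ hi), hi'⟩
    · rw [Finset.card_erase_of_mem hj']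
      omega

/-! ### The monomial case. -/

/-- All weights are at least `m`, and on each singular stratum some weight equals `m`. -/
def Monomial (P : WeightedFabric α) (d : ℕ) (m : P.fabric.I → ℕ) : Prop :=
  (∀ s i, m i ≤ P.weight s i) ∧
    ∀ K ∈ P.singular (fun _ => d), ∃ s, ∀ i ∈ K, P.weight s i = m i

/-- The weight `m` on the blow-up centered in `J`. -/
def extend {ι : Type*} (d : ℕ) (J : Finset ι) (m : ι → ℕ) : Option ι → ℕ :=
  fun o => o.elim (∑ j ∈ J, m j - d) m

/-- A weight that equals `m` on `K ⊇ J` equals it on `J`, hence also at the new index. -/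
theorem Monomial.blowUp {P : WeightedFabric α} {d : ℕ} {m : P.fabric.I → ℕ} (h : P.Monomial d m)
    {J : Finset P.fabric.I} (hJ : J ∈ P.singular (fun _ => d)) :
    (P.blowUp (fun _ => d) J).Monomial d (extend d J m) := by
  refine ⟨?_, fun K' hK' => ?_⟩
  · rintro s (_ | i)
    · exact Nat.sub_le_sub_right (Finset.sum_le_sum fun i _ => h.1 s i) d
    · exact h.1 s i
  rcases singular_blowUp_cases hJ hK' with ⟨L, hL, -, rfl⟩ | ⟨K, hK, hJK, A, hA, rfl⟩
  · obtain ⟨s, hs⟩ := h.2 L hL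
    refine ⟨s, fun i hi => ?_⟩
    obtain ⟨i, hi', rfl⟩ := Finset.mem_map.1 hi
    exact hs i hi'
  · obtain ⟨s, hs⟩ := h.2 K hK
    refine ⟨s, ?_⟩
    rintro (_ | i) hi
    · change ∑ j ∈ J, P.weight s j - d = ∑ j ∈ J, m j - d
      rw [Finset.sum_congr rfl fun i hi => hs i (hJK hi)]
    · have hi' : i ∈ K \ J ∪ A := Finset.some_mem_insertNone.1 hi
      refine hs i ?_
      exact (Finset.mem_union.1 hi').elim (fun h => (Finset.mem_sdiff.1 h).1)
          fun h => hJK (hA.1 h)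

/-- With `Monomial.mem_singular`: a stratum is singular exactly when its `m`-total is at least `d`.
-/
theorem Monomial.le_sum {P : WeightedFabric α} {d : ℕ} {m : P.fabric.I → ℕ}
    (h : P.Monomial d m) {K : Finset P.fabric.I} (hK : K ∈ P.singular (fun _ => d)) :
    d ≤ ∑ i ∈ K, m i := by
  obtain ⟨s, hs⟩ := h.2 K hK
  exact (hK.2 s).trans_eq (Finset.sum_congr rfl hs)

theorem Monomial.mem_singular {P : WeightedFabric α} {d : ℕ} {m : P.fabric.I → ℕ}
    (h : P.Monomial d m) {K : Finset P.fabric.I} (hK : K ∈ P.fabric.strata)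
    (hd : d ≤ ∑ i ∈ K, m i) : K ∈ P.singular (fun _ => d) :=
  ⟨hK, fun s => hd.trans (Finset.sum_le_sum fun i _ => h.1 s i)⟩

/-- Blowing up a minimal singular stratum makes the exceptional strata smaller. -/
theorem sum_exceptional_lt {ι : Type*} [DecidableEq ι] {d : ℕ} {m : ι → ℕ} {J K A : Finset ι}
    (hJ : d ≤ ∑ i ∈ J, m i) (hmin : ∀ j ∈ J, ∑ i ∈ J.erase j, m i < d) (hJK : J ⊆ K)
    (hA : A ⊂ J) :
    ∑ i ∈ Finset.insertNone ((K \ J) ∪ A), extend d J m i < ∑ i ∈ K, m i := by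
  obtain ⟨j, hj, hjA⟩ := Finset.exists_of_ssubset hA
  have h1 : ∑ i ∈ A, m i ≤ ∑ i ∈ J.erase j, m i :=
    Finset.sum_le_sum_of_subset (Finset.subset_erase.2 ⟨hA.1, hjA⟩)
  have h2 := hmin j hj
  have h3 := Finset.sum_sdiff (f := m) hJK
  rw [sum_exceptional _ hA.1]
  change (∑ i ∈ J, m i - d) + (∑ i ∈ K \ J, m i + ∑ i ∈ A, m i) < _
  omega

/-- Lexicographic induction on a strict bound for the `m`-totals of singular strata and on the
number of singular strata of top total. A minimal singular center inside a top stratum destroys that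
stratum, replaces strata over the center by ones of smaller total, and creates no new top stratum.
-/
theorem Monomial.resolvable {P : WeightedFabric α} {d : ℕ} (hd : 0 < d) {m : P.fabric.I → ℕ}
    (h : P.Monomial d m) : Resolvable (fun _ => d) P := by
  obtain ⟨M, hM⟩ : ∃ M, ∀ K ∈ P.singular (fun _ => d), ∑ i ∈ K, m i < M :=
    ⟨∑ i, m i + 1, fun K _ => Nat.lt_succ_of_le (Finset.sum_le_sum_of_subset K.subset_univ)⟩
  induction M generalizing P with
  | zero =>
    exact ⟨P, .refl, Set.eq_empty_iff_forall_notMem.2 fun K hK => absurd (hM K hK) (by simp)⟩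
  | succ M ihM =>
    induction hc : {K | K ∈ P.singular (fun _ => d) ∧ ∑ i ∈ K, m i = M}.ncard
      using Nat.strong_induction_on generalizing P with
    | _ c ihc =>
    by_cases he : ∃ K ∈ P.singular (fun _ => d), ∑ i ∈ K, m i = M
    · obtain ⟨K, hK, hKM⟩ := he
      obtain ⟨J, hJK, hJ⟩ := (Set.toFinite {J | J ∈ P.singular (fun _ => d)}).exists_le_minimal hK
      have hJd := h.le_sum hJ.prop
      have hmin : ∀ j ∈ J, ∑ i ∈ J.erase j, m i < d := by
        intro j hj
        by_contra! hlt
        exact Finset.notMem_erase j J (hJ.le_of_le (h.mem_singular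
          (P.fabric.isOpen J hJ.prop.1 _ (Finset.erase_subset _ _)) hlt)
          (Finset.erase_subset _ _) hj)
      have hne : J.Nonempty := by
        rw [Finset.nonempty_iff_ne_empty]
        rintro rfl
        simp at hJd
        omega
      have hdec : ∀ K' ∈ (P.blowUp (fun _ => d) J).singular (fun _ => d),
          (∃ L ∈ P.singular (fun _ => d), ¬ J ⊆ L ∧ K' = L.map Function.Embedding.some ∧
            ∑ i ∈ K', extend d J m i = ∑ i ∈ L, m i) ∨ ∑ i ∈ K', extend d J m i < M := by
        intro K' hK'
        rcases singular_blowUp_cases hJ.prop hK' with ⟨L, hL, hJL, rfl⟩ | ⟨K₁, hK₁, hJK₁, A, hA, rfl⟩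
        · exact Or.inl ⟨L, hL, hJL, rfl, Finset.sum_map _ _ _⟩
        · exact Or.inr ((sum_exceptional_lt hJd hmin hJK₁ hA).trans_le
            (Nat.le_of_lt_succ (hM K₁ hK₁)))
      refine .of_reach (.single ⟨J, hJ.prop, hne, rfl⟩) (ihc _ ?_ (h.blowUp hJ.prop) ?_ rfl)
      · rw [← hc]
        have hfin : {K | K ∈ P.singular (fun _ => d) ∧ ∑ i ∈ K, m i = M}.Finite := Set.toFinite _
        refine lt_of_le_of_lt ?_ (Set.ncard_lt_ncard (Set.sdiff_singleton_ssubset.2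
          (show K ∈ {K | K ∈ P.singular (fun _ => d) ∧ ∑ i ∈ K, m i = M} from ⟨hK, hKM⟩)) hfin)
        -- Top strata after the blow-up are images of old top strata not containing `J`; `K`
        -- contains `J` and is lost.
        refine le_trans (Set.ncard_le_ncard (t := (fun L => L.map Function.Embedding.some) ''
          ({K | K ∈ P.singular (fun _ => d) ∧ ∑ i ∈ K, m i = M} \ {K})) ?_
          ((hfin.sdiff).image _)) (Set.ncard_image_le hfin.sdiff)
        rintro K' ⟨hK', hM'⟩
        rcases hdec K' hK' with ⟨L, hL, hJL, rfl, hsum⟩ | hlt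
        · exact ⟨L, ⟨⟨hL, hsum.symm.trans hM'⟩, fun e => hJL (e ▸ hJK)⟩, rfl⟩
        · exact absurd hM' hlt.ne
      · intro K' hK'
        rcases hdec K' hK' with ⟨L, hL, hJL, rfl, hsum⟩ | hlt
        · exact hsum.trans_lt (hM L hL)
        · exact hlt.trans (Nat.lt_succ_self M)
    · push Not at he
      exact ihM h fun K hK => lt_of_le_of_ne (Nat.le_of_lt_succ (hM K hK)) (he K hK)

/-! ### Splitting off a common part, and the main induction. -/

/-- Adding the weights `b` with threshold `μ` to a family. -/
def adjoin (P : WeightedFabric α) (b : α → P.fabric.I → ℕ) : WeightedFabric (α ⊕ α) :=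
  ⟨P.fabric, Sum.elim b P.weight⟩

/-- The difference of the two weights of each index is independent of the index. -/
def CommonPart (P : WeightedFabric (α ⊕ α)) : Prop :=
  ∃ m : P.fabric.I → ℕ, ∀ s i, P.weight (.inr s) i = m i + P.weight (.inl s) i

/-- On the new index, `∑ w - d = (∑ m + μ - d) + (∑ b - μ)`. No subtraction is truncated: a
controlling `t` has `∑ b_t ≤ μ` and `d ≤ ∑ w_t`, so `d ≤ ∑ m + μ`. -/
theorem CommonPart.blowUp {P : WeightedFabric (α ⊕ α)} (h : P.CommonPart) {μ d : ℕ}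
    {T : Finset P.fabric.I}
    (hT : P.Controlled (Sum.elim (fun _ => μ) (fun _ => d)) (fun s => s.isLeft) T)
    {J : Finset P.fabric.I} (hJ : J ∈ P.singular (Sum.elim (fun _ => μ) (fun _ => d))) :
    (P.blowUp (Sum.elim (fun _ => μ) (fun _ => d)) J).CommonPart := by
  obtain ⟨m, hm⟩ := h
  refine ⟨fun o : Option P.fabric.I => o.elim (∑ j ∈ J, m j + μ - d) m, ?_⟩
  rintro s (_ | i)
  · have key : ∀ s, ∑ j ∈ J, P.weight (.inr s) j = ∑ j ∈ J, m j + ∑ j ∈ J, P.weight (.inl s) j := by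
      intro s
      rw [← Finset.sum_add_distrib]
      exact Finset.sum_congr rfl fun j _ => hm s j
    obtain ⟨t | t, ht, hle, -⟩ := hT J hJ
    · have h1 : ∑ j ∈ J, P.weight (.inl t) j ≤ μ := hle
      have h2 : d ≤ ∑ j ∈ J, P.weight (.inr t) j := hJ.2 (.inr t)
      have h3 : μ ≤ ∑ j ∈ J, P.weight (.inl s) j := hJ.2 (.inl s)
      have h4 := key s
      have h5 := key t
      change ∑ j ∈ J, P.weight (.inr s) j - d =
        (∑ j ∈ J, m j + μ - d) + (∑ j ∈ J, P.weight (.inl s) j - μ)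
      omega
    · simp at ht
  · exact hm s i

theorem CommonPart.reach {P Q : WeightedFabric (α ⊕ α)} (h : P.CommonPart) {μ d : ℕ}
    {T : Finset P.fabric.I}
    (hT : P.Controlled (Sum.elim (fun _ => μ) (fun _ => d)) (fun s => s.isLeft) T)
    (hQ : Reach (Sum.elim (fun _ => μ) (fun _ => d)) P Q) : Q.CommonPart := by
  induction hQ with
  | refl => exact h
  | tail hr hs ih =>
    obtain ⟨T', hT'⟩ := hT.reach hr
    obtain ⟨J, hJ, -, rfl⟩ := hs
    exact ih.blowUp hT' hJ

/-- Descent on `μ`. At `μ = 0` some residual weight vanishes on each singular stratum, which is the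
monomial case with `m` the common part. -/
theorem CommonPart.resolvable {n : ℕ}
    (ih : ∀ {β : Type u} [Nonempty β] (d : β → ℕ), (∀ s, 0 < d s) → BddAbove (Set.range d) →
      ∀ Q : WeightedFabric β, Q.DimLE n → Resolvable d Q)
    {d : ℕ} (hd : 0 < d) (μ : ℕ) {P : WeightedFabric (α ⊕ α)} (h : P.CommonPart)
    (hn : P.DimLE (n + 1))
    (hμ : ∀ K ∈ (P.comap Sum.inr).singular (fun _ => d),
      ∃ s, ∑ i ∈ K, P.weight (.inl s) i ≤ μ) :
    Resolvable (fun _ => d) (P.comap Sum.inr) := by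
  induction μ generalizing P with
  | zero =>
    obtain ⟨m, hm⟩ := h
    refine Monomial.resolvable hd (m := m) ⟨fun s i => ?_, fun K hK => ?_⟩
    · exact (Nat.le_add_right _ _).trans_eq (hm s i).symm
    · obtain ⟨s, hs⟩ := hμ K hK
      refine ⟨s, fun i hi => (hm s i).trans ?_⟩
      rw [Finset.sum_eq_zero_iff.1 (Nat.le_zero.1 hs) i hi, Nat.add_zero]
  | succ μ ihμ =>
    -- With `T` the whole index set, the support condition is vacuous.
    have hT : P.Controlled (Sum.elim (fun _ => μ + 1) (fun _ => d)) (fun s => s.isLeft)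
        Finset.univ := by
      intro K hK
      obtain ⟨s, hs⟩ := hμ K ⟨hK.1, fun s => hK.2 (.inr s)⟩
      exact ⟨.inl s, rfl, hs, fun i _ hi => absurd (Finset.mem_univ i) hi⟩
    obtain ⟨Q, hQ, h0⟩ := hT.resolvable ih (by rintro (s | s) <;> simp [hd]) (by
      refine ⟨max (μ + 1) d, ?_⟩
      rintro _ ⟨s | s, rfl⟩ <;> simp) hn
    refine .of_reach (hQ.comap Sum.inr) (ihμ (h.reach hT hQ) (hn.reach hQ) fun K hK => ?_)
    by_contra! hlt
    -- A stratum on which all residual totals exceed `μ` would be singular for the enlarged family,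
    -- whose singular locus is now empty.
    refine Set.eq_empty_iff_forall_notMem.1 h0 K ⟨hK.1, ?_⟩
    rintro (s | s)
    · exact hlt s
    · exact hK.2 s

/-- Every weighted fabric with bounded positive thresholds is resolvable. -/
theorem resolvable_of_dimLE (n : ℕ) {α : Type u} [Nonempty α] (d : α → ℕ) (hd : ∀ s, 0 < d s)
    (hB : BddAbove (Set.range d)) (P : WeightedFabric α) (hn : P.DimLE n) : Resolvable d P := by
  induction n generalizing α with
  | zero =>
    refine ⟨P, .refl, Set.eq_empty_iff_forall_notMem.2 fun K hK => ?_⟩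
    -- Non-emptiness of the family matters: for an empty family the empty stratum is singular.
    have h1 := hK.2 (Classical.arbitrary α)
    rw [Finset.card_eq_zero.1 (Nat.le_zero.1 (hn K hK.1)), Finset.sum_empty] at h1
    exact (hd _).not_ge h1
  | succ n ih =>
    obtain ⟨B, hB⟩ := hB
    -- Boundedness of the thresholds gives them a common multiple, here `B!`.
    have hdvd : ∀ s, d s ∣ B.factorial := fun s => Nat.dvd_factorial (hd s) (hB ⟨s, rfl⟩)
    have hc : ∀ s, 0 < B.factorial / d s := fun s =>
      Nat.div_pos (Nat.le_of_dvd B.factorial_pos (hdvd s)) (hd s)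
    refine Resolvable.of_scale hc ?_
    simp only [fun s => Nat.div_mul_cancel (hdvd s)]
    let R := P.scale fun s => B.factorial / d s
    let s₀ := Classical.arbitrary α
    -- The descent starts from `m = 0`, with residuals equal to the weights; the full total of any
    -- one weight serves as `μ`.
    refine CommonPart.resolvable (fun {β} _ => ih) B.factorial_pos (∑ i, R.weight s₀ i)
      (P := R.adjoin R.weight) ⟨fun _ => 0, fun s i => (Nat.zero_add _).symm⟩ hn fun K _ =>
      ⟨s₀, Finset.sum_le_sum_of_subset K.subset_univ⟩

theorem resolvable [Nonempty α] {d : ℕ} (hd : 0 < d) (P : WeightedFabric α) :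
    Resolvable (fun _ => d) P :=
  resolvable_of_dimLE (Fintype.card P.fabric.I) _ (fun _ => hd) ⟨d, by rintro _ ⟨_, rfl⟩; rfl⟩ P
    fun K _ => K.card_le_univ

end WeightedFabric

/-! ### From polyhedra systems to weighted fabrics. -/

namespace PolyhedraSystem

variable {α : Type u}

/-- The vectors in `ℝ^J` given by a family of natural weights. -/
def weightVectors {I : Type u} (w : α → I → ℕ) (J : Finset I) : Set (J → ℝ) :=
  Set.range fun s (j : J) => (w s j : ℝ)

/-- The polyhedra of the Newton polyhedra system `N` are generated by the weights of `P`. -/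
def GeneratedBy (N : PolyhedraSystem.{u}) (P : WeightedFabric α) : Prop :=
  N.denom = 1 ∧ ∃ w : α → N.fabric.I → ℕ, P = ⟨N.fabric, w⟩ ∧
    ∀ J : N.fabric.strata, N.polyhedron J = posConvexHull (weightVectors w J)

/-- A point of `Δ_J` with natural coordinates extends to a natural weight whose restriction to
each stratum `K` is in `Δ_K`. -/
theorem exists_extension (N : PolyhedraSystem.{u}) (J : N.fabric.strata) {n : J.1 → ℕ}
    (hn : (fun j => (n j : ℝ)) ∈ N.polyhedron J) :
    ∃ v : N.fabric.I → ℕ, (∀ j : J.1, v j = n j) ∧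
      ∀ K : N.fabric.strata, (fun k : K.1 => (v k : ℝ)) ∈ N.polyhedron K := by
  -- Compatibility through `K ∩ J` gives a point of `Δ_K` agreeing with `n` there. A constant `M`
  -- dominating all these points is the value outside `J`, so each restriction is such a point plus
  -- a non-negative vector.
  have hτ : ∀ K : N.fabric.strata, ∃ τ ∈ N.polyhedron K, ∀ k : K.1, ∀ hk : k.1 ∈ J.1,
      τ k = n ⟨k, hk⟩ := by
    intro K
    have hJK : K.1 ∩ J.1 ∈ N.fabric.strata := N.fabric.isOpen _ K.2 _ Finset.inter_subset_left
    have h1 : Finset.restrict₂ (π := fun _ => ℝ) Finset.inter_subset_right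
        (fun j : J.1 => (n j : ℝ)) ∈ N.polyhedron ⟨K.1 ∩ J.1, hJK⟩ := by
      rw [N.compat ⟨K.1 ∩ J.1, hJK⟩ J Finset.inter_subset_right]
      exact ⟨_, hn, rfl⟩
    rw [N.compat ⟨K.1 ∩ J.1, hJK⟩ K Finset.inter_subset_left] at h1
    obtain ⟨τ, hτ, h⟩ := h1
    exact ⟨τ, hτ, fun k hk => congrFun h ⟨k.1, Finset.mem_inter.2 ⟨k.2, hk⟩⟩⟩
  choose τ hτ hτJ using hτ
  obtain ⟨M, hM⟩ : ∃ M : ℕ, ∀ x : (Σ K : N.fabric.strata, K.1), τ x.1 x.2 ≤ M := by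
    obtain ⟨r, hr⟩ := (Set.finite_range
      fun x : (Σ K : N.fabric.strata, K.1) => τ x.1 x.2).bddAbove
    obtain ⟨M, hM⟩ := exists_nat_ge r
    exact ⟨M, fun x => (hr ⟨x, rfl⟩).trans hM⟩
  refine ⟨fun i => if h : i ∈ J.1 then n ⟨i, h⟩ else M, fun j => by simp, fun K => ?_⟩
  obtain ⟨A, -, hA⟩ := N.isChar K
  have h1 := hτ K
  rw [hA] at h1 ⊢
  convert posConvexHull_idem_aux h1 (τ := fun k : K.1 => if k.1 ∈ J.1 then 0 else M - τ K k) ?_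
    using 1
  · funext k
    by_cases hk : k.1 ∈ J.1
    · simp [hk, hτJ K k hk]
    · simp [hk]
  · intro k
    split_ifs
    · exact le_rfl
    · exact sub_nonneg.2 (hM ⟨K, k⟩)

/-- The family consists of all natural weights lying in every polyhedron; by `exists_extension` each
generator of each `Δ_J` is a restriction of one of them. -/
theorem IsNewton.exists_generatedBy {N : PolyhedraSystem.{u}} (hN : N.IsNewton) :
    ∃ (α : Type u) (_ : Nonempty α) (P : WeightedFabric α), N.GeneratedBy P := by
  have hA : ∀ J : N.fabric.strata, ∃ A : Set (J.1 → ℝ),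
      (∀ σ ∈ A, ∃ n : J.1 → ℕ, σ = fun j => (n j : ℝ)) ∧ N.polyhedron J = posConvexHull A := by
    intro J
    obtain ⟨A, hA, h⟩ := N.isChar J
    refine ⟨A, fun σ hσ => ?_, h⟩
    choose n hn using hA σ hσ
    refine ⟨n, funext fun j => ?_⟩
    rw [hn j, show N.denom = 1 from hN, Nat.cast_one, div_one]
  let α := {v : N.fabric.I → ℕ //
    ∀ K : N.fabric.strata, (fun k : K.1 => (v k : ℝ)) ∈ N.polyhedron K}
  refine ⟨α, ?_, ⟨N.fabric, fun s => s.1⟩, hN, _, rfl, fun J => ?_⟩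
  · by_cases h : Nonempty N.fabric.strata
    · obtain ⟨J⟩ := h
      obtain ⟨A, hA, hJ⟩ := hA J
      obtain ⟨σ, hσ⟩ : A.Nonempty := by
        rw [Set.nonempty_iff_ne_empty]
        rintro rfl
        have := N.nonempty J
        rw [hJ] at this
        simp [posConvexHull] at this
      obtain ⟨n, rfl⟩ := hA σ hσ
      obtain ⟨v, -, hv⟩ := N.exists_extension J (hJ ▸ subset_posConvexHull A hσ)
      exact ⟨⟨v, hv⟩⟩
    · exact ⟨⟨fun _ => 0, fun K => absurd ⟨K⟩ h⟩⟩
  · obtain ⟨A, hA, hJ⟩ := hA J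
    apply subset_antisymm
    · rw [hJ]
      refine posConvexHull_min fun σ hσ => subset_posConvexHull _ ?_
      obtain ⟨n, rfl⟩ := hA σ hσ
      obtain ⟨v, hvn, hv⟩ := N.exists_extension J (hJ ▸ subset_posConvexHull A hσ)
      exact ⟨⟨v, hv⟩, funext fun j => congrArg Nat.cast (hvn j)⟩
    · rw [hJ]
      refine posConvexHull_min ?_
      rintro _ ⟨s, rfl⟩
      exact hJ ▸ s.2 J

theorem le_sum_of_mem_posConvexHull {ι : Type*} [Fintype ι] {A : Set (ι → ℝ)} {c : ℝ}
    (hA : ∀ σ ∈ A, c ≤ ∑ j, σ j) : ∀ σ ∈ posConvexHull A, c ≤ ∑ j, σ j := by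
  intro σ hσ
  refine convexHull_min (t := {σ : ι → ℝ | c ≤ ∑ j, σ j}) ?_ ?_ hσ
  · rintro _ ⟨a, ha, t, ht, rfl⟩
    have h1 : 0 ≤ ∑ j, t j := Finset.sum_nonneg fun j _ => ht j
    have h2 := hA a ha
    simp only [Set.mem_ofPred_eq, Pi.add_apply, Finset.sum_add_distrib]
    linarith
  · intro x hx y hy a b ha hb hab
    simp only [Set.mem_ofPred_eq, Pi.add_apply, Pi.smul_apply, smul_eq_mul,
      Finset.sum_add_distrib, ← Finset.mul_sum] at hx hy ⊢
    calc c = a * c + b * c := by rw [← add_mul, hab, one_mul]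
      _ ≤ _ := by gcongr

/-- `c ≤ δ(Δ_J)` if all the generators have total at least `c`. -/
theorem le_polyhedronContactExponent {I : Type u} {J : Finset I} (hJ : J.Nonempty)
    {A : Set (J → ℝ)} (hne : (posConvexHull A).Nonempty) {c : ℝ} (hA : ∀ σ ∈ A, c ≤ ∑ j, σ j) :
    c ≤ polyhedronContactExponent (posConvexHull A) := by
  rw [polyhedronContactExponent, if_neg hJ.ne_empty]
  refine le_csInf (hne.image _) ?_
  rintro _ ⟨σ, hσ, rfl⟩
  exact le_sum_of_mem_posConvexHull hA σ hσ

theorem polyhedronContactExponent_le (N : PolyhedraSystem.{u}) (J : N.fabric.strata)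
    (hJ : J.1.Nonempty) {σ : J.1 → ℝ} (hσ : σ ∈ N.polyhedron J) :
    polyhedronContactExponent (N.polyhedron J) ≤ ∑ j, σ j := by
  rw [polyhedronContactExponent, if_neg hJ.ne_empty]
  refine csInf_le ⟨0, ?_⟩ ⟨σ, hσ, rfl⟩
  rintro _ ⟨τ, hτ, rfl⟩
  exact Finset.sum_nonneg fun j _ => N.polyhedron_nonneg J τ hτ j

theorem sum_weightVector {I : Type u} (w : I → ℕ) (J : Finset I) :
    ∑ j : J, (w j : ℝ) = ((∑ j ∈ J, w j : ℕ) : ℝ) := by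
  rw [Nat.cast_sum]
  exact Finset.sum_coe_sort J fun j => (w j : ℝ)

/-- The vectors generating the polyhedra of the moderated transform. -/
theorem weightVectors_blowUp (F : SupportFabric.{u}) (w : α → F.I → ℕ) {d : ℕ} (hd : 0 < d)
    {J : Finset F.I} (hJ : ∀ s, d ≤ ∑ j ∈ J, w s j) (J' : Finset (Option F.I)) :
    (d : ℝ) • ((fun σ => σ - SupportFabric.eInfty J') ''
      (F.blowUpLin J J' '' ((1 / (d : ℝ)) • weightVectors w (F.blowUpMap J J')))) =
    weightVectors (I := Option F.I)
      ((WeightedFabric.mk F w).blowUp (fun _ => d) J).weight J' := by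
  have hd' : (d : ℝ) ≠ 0 := Nat.cast_ne_zero.2 hd.ne'
  have key : ∀ s, (d : ℝ) • (F.blowUpLin J J' ((1 / (d : ℝ)) •
      fun i : F.blowUpMap J J' => (w s i : ℝ)) - SupportFabric.eInfty J') =
      fun j : J' => (((WeightedFabric.mk F w).blowUp (fun _ => d) J).weight s j.1 : ℝ) := by
    intro s
    funext ⟨j, hj⟩
    cases j with
    | some i =>
      change (d : ℝ) * ((1 / (d : ℝ)) * (w s i : ℝ) - 0) = (w s i : ℝ)
      field_simp
      ring
    | none =>
      change (d : ℝ) * (∑ j : J, (1 / (d : ℝ)) * (w s j : ℝ) - 1) =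
        ((∑ j ∈ J, w s j - d : ℕ) : ℝ)
      rw [Nat.cast_sub (hJ s), ← sum_weightVector, ← Finset.mul_sum]
      field_simp
  ext x
  constructor
  · rintro ⟨_, ⟨_, ⟨_, ⟨_, ⟨s, rfl⟩, rfl⟩, rfl⟩, rfl⟩, rfl⟩
    exact ⟨s, (key s).symm⟩
  · rintro ⟨s, rfl⟩
    exact ⟨_, ⟨_, ⟨_, ⟨_, ⟨s, rfl⟩, rfl⟩, rfl⟩, rfl⟩, key s⟩

/-- The operations of the transform commute with `[[·]]`, so only the generating vectors have to be
followed. -/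
theorem GeneratedBy.exists_moderatedTransform {N : PolyhedraSystem.{u}} {P Q : WeightedFabric α}
    {d : ℕ} (hd : 0 < d) (h : N.GeneratedBy P)
    (hQ : WeightedFabric.Step (fun _ => d) P Q) :
    ∃ N', IsModeratedTransform d hd N N' ∧ N'.GeneratedBy Q := by
  obtain ⟨h1, w, rfl, hw⟩ := h
  obtain ⟨(J : Finset N.fabric.I), hJ, hne, rfl⟩ := hQ
  have hd' : (0 : ℝ) < d := Nat.cast_pos.2 hd
  have hdiv : ∀ K : N.fabric.strata, (N.divBy d hd).polyhedron K =
      posConvexHull ((1 / (d : ℝ)) • weightVectors w K) := fun K => by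
    change (1 / (d : ℝ)) • N.polyhedron K = _
    rw [hw, smul_posConvexHull (by positivity)]
  have hsing : (⟨J, hJ.1⟩ : N.fabric.strata) ∈ (N.divBy d hd).Sing := by
    have hJd := hdiv ⟨J, hJ.1⟩
    refine (le_polyhedronContactExponent hne ((congrArg Set.Nonempty hJd).mp
      ((N.divBy d hd).nonempty ⟨J, hJ.1⟩)) ?_).trans_eq
      (congrArg polyhedronContactExponent hJd).symm
    rintro _ ⟨_, ⟨s, rfl⟩, rfl⟩
    change 1 ≤ ∑ j : J, (1 / (d : ℝ)) * (w s j : ℝ)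
    rw [← Finset.mul_sum, sum_weightVector, one_div, ← div_eq_inv_mul, one_le_div₀ hd']
    exact_mod_cast hJ.2 s
  refine ⟨N.moderatedTransform d hd ⟨J, hJ.1⟩ hsing, ⟨_, hsing, rfl⟩, rfl, _, rfl, fun J' => ?_⟩
  change ((N.denom * d : ℕ) : ℝ) • ((fun σ => σ - SupportFabric.eInfty J'.1) ''
    (N.divBy d hd).totalPolyhedron ⟨J, hJ.1⟩ J') = _
  rw [(N.divBy d hd).totalPolyhedron_eq_aux ⟨J, hJ.1⟩ J' _ (hdiv _), image_sub_posConvexHull, h1,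
    one_mul, smul_posConvexHull hd']
  exact congrArg posConvexHull (weightVectors_blowUp N.fabric w hd hJ.2 J'.1)

theorem GeneratedBy.exists_sequence {d : ℕ} (hd : 0 < d) {P Q : WeightedFabric α}
    (hQ : WeightedFabric.Reach (fun _ => d) P Q) {N : PolyhedraSystem.{u}} (h : N.GeneratedBy P) :
    ∃ (k : ℕ) (S : ℕ → PolyhedraSystem.{u}), S 0 = N ∧
      (∀ i < k, IsModeratedTransform d hd (S i) (S (i + 1))) ∧ (S k).GeneratedBy Q := by
  induction hQ using Relation.ReflTransGen.head_induction_on generalizing N with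
  | refl => exact ⟨0, fun _ => N, rfl, fun i hi => absurd hi (Nat.not_lt_zero i), h⟩
  | head hs _ ih =>
    obtain ⟨N', hN', h'⟩ := h.exists_moderatedTransform hd hs
    obtain ⟨k, S, h0, hS, hk⟩ := ih h'
    refine ⟨k + 1, fun i => i.casesOn N S, rfl, ?_, hk⟩
    rintro (_ | i) hi
    · rw [← h0] at hN'
      exact hN'
    · exact hS i (Nat.lt_of_succ_lt_succ hi)

theorem GeneratedBy.contactExponent_lt {N : PolyhedraSystem.{u}} {P : WeightedFabric α} {d : ℕ}
    (h : N.GeneratedBy P) (h0 : P.singular (fun _ => d) = ∅) :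
    N.contactExponent < (d : EReal) := by
  obtain ⟨-, w, rfl, hw⟩ := h
  have hlt : ∀ J : N.fabric.strata, polyhedronContactExponent (N.polyhedron J) < d := by
    intro J
    rcases J.1.eq_empty_or_nonempty with he | hne
    -- On the empty stratum the convention `-1` applies.
    · rw [polyhedronContactExponent, if_pos he]
      linarith [Nat.cast_nonneg (α := ℝ) d]
    · obtain ⟨s, hs⟩ : ∃ s, ∑ j ∈ J.1, w s j < d := by
        by_contra! hge
        exact Set.eq_empty_iff_forall_notMem.1 h0 J.1 ⟨J.2, hge⟩
      refine (N.polyhedronContactExponent_le J hne (σ := fun j => (w s j : ℝ)) ?_).trans_lt ?_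
      · rw [hw]
        exact subset_posConvexHull _ ⟨s, rfl⟩
      · rw [sum_weightVector]
        exact_mod_cast hs
  unfold contactExponent
  rcases isEmpty_or_nonempty N.fabric.strata with he | hne
  · rw [iSup_of_empty]
    exact EReal.bot_lt_coe d
  -- The supremum is attained, so the strict inequality survives.
  · obtain ⟨J, hJ⟩ := exists_eq_ciSup_of_finite (f := fun J : N.fabric.strata =>
      (polyhedronContactExponent (N.polyhedron J) : EReal))
    rw [← hJ]
    exact_mod_cast hlt J

end PolyhedraSystem

theorem mainTheorem3 (N : PolyhedraSystem.{u}) (hN : N.IsNewton) (d : ℕ) (hd : 0 < d) :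
    ∃ (k : ℕ) (S : ℕ → PolyhedraSystem.{u}), S 0 = N ∧
      (∀ i < k, PolyhedraSystem.IsModeratedTransform d hd (S i) (S (i + 1))) ∧
      (S k).contactExponent < (d : EReal) := by
  obtain ⟨α, _, P, hP⟩ := hN.exists_generatedBy
  obtain ⟨Q, hQ, h0⟩ := P.resolvable hd
  obtain ⟨k, S, hS0, hS, hk⟩ := hP.exists_sequence hd hQ
  exact ⟨k, S, hS0, hS, hk.contactExponent_lt h0⟩
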